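/- Let $n_{\mathrm{in}} \ge n_{\mathrm{hid}} \ge 1$ and $p \ge 0$ be integers, $T \ge 0$, and let $\mathcal X \subset \mathbb R^{n_{\mathrm{in}}}$ be open. Let $\lambda \in C^1(\mathbb R^{n_{\mathrm{in}}}, \mathbb R^{n_{\mathrm{hid}}})$, $\tilde\lambda \in C^1(\mathbb R^{n_{\mathrm{hid}}}, \mathbb R)$ and $\theta \in C^0([0,T], \mathbb R^p)$, and let $f : \mathbb R^{n_{\mathrm{hid}}} \times \mathbb R^p \to \mathbb R^{n_{\mathrm{hid}}}$ be continuously differentiable in its first variable, with $f$ and $\partial_h f$ jointly continuous in $(h,\theta)$. Assume that for every $a \in \lambda(\mathcal X)$ the initial value problem $$\frac{\mathrm d h}{\mathrm d t} = f(h(t), \theta(t)), \qquad h(0) = a,$$ has a unique solution $h_a$ on $[0,T]$. Let $\overline\Phi : \mathcal X \to \mathbb R$, $\overline\Phi(x) = \tilde\lambda(h_{\lambda(x)}(T))$, be the corresponding scalar non-augmented neural ODE. Assume that the Jacobian matrix $\partial_x\lambda(x)$ has full rank $n_{\mathrm{hid}}$ for every $x \in \mathbb R^{n_{\mathrm{in}}}$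 and that the Jacobian matrix $\partial_y\tilde\lambda(y)$ has full rank $1$ for every $y \in \mathbb R^{n_{\mathrm{hid}}}$. Then $\overline\Phi$ has no critical points: for every $x \in \mathcal X$, $\overline\Phi$ is differentiable at $x$ and $\nabla_x \overline\Phi(x) \ne 0$. -/

import Mathlib

noncomputable section

/-- `f ∈ C^{k,0}(E × P, F)`: `f` is `k` times continuously differentiable in its first variable,
and `f` and all its partial derivatives of order at most `k` with respect to the first variable
are continuous functions of both variables together. -/
def IsCk0 {E P F : Type*} [NormedAddCommGroup E] [NormedSpace ℝ E] [TopologicalSpace P]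
    [NormedAddCommGroup F] [NormedSpace ℝ F] (k : ℕ) (f : E → P → F) : Prop :=
  (∀ y : P, ContDiff ℝ k (fun h => f h y)) ∧
    ∀ m : ℕ, m ≤ k → Continuous (fun q : E × P => iteratedFDeriv ℝ m (fun h => f h q.2) q.1)

/-- `h` restricted to `[0, T]` solves `dh/dt = f (h(t), θ(t))`, `h(0) = a`, on `[0, T]`
(one-sided derivatives at the end points). -/
def IsIVPSolution {E P : Type*} [NormedAddCommGroup E] [NormedSpace ℝ E]
    (f : E → P → E) (θ : ℝ → P) (T : ℝ) (a : E) (h : ℝ → E) : Prop :=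
  h 0 = a ∧ ∀ t ∈ Set.Icc 0 T, HasDerivWithinAt h (f (h t) (θ t)) (Set.Icc 0 T) t

/-- A neural ODE architecture of regularity `k ≥ 1` on the open set `X ⊆ ℝ^nin`, with hidden
dimension `nhid`, output dimension `nout` and parameter functions with values in `ℝ^p`. -/
structure NeuralODE (k nin nhid nout p : ℕ) (X : Set (EuclideanSpace ℝ (Fin nin))) where
  one_le_k : 1 ≤ k
  isOpen_X : IsOpen X
  /-- the time horizon -/
  T : ℝ
  T_nonneg : 0 ≤ T
  /-- the input transformation -/
  lamIn : EuclideanSpace ℝ (Fin nin) → EuclideanSpace ℝ (Fin nhid)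
  lamIn_contDiff : ContDiff ℝ k lamIn
  /-- the output transformation -/
  lamOut : EuclideanSpace ℝ (Fin nhid) → EuclideanSpace ℝ (Fin nout)
  lamOut_contDiff : ContDiff ℝ k lamOut
  /-- the parameter function; only its values on `[0, T]` matter -/
  θ : ℝ → EuclideanSpace ℝ (Fin p)
  θ_continuousOn : ContinuousOn θ (Set.Icc 0 T)
  /-- the vector field -/
  f : EuclideanSpace ℝ (Fin nhid) → EuclideanSpace ℝ (Fin p) → EuclideanSpace ℝ (Fin nhid)
  f_regular : IsCk0 k f
  exists_solution : ∀ a ∈ lamIn '' X, ∃ h, IsIVPSolution f θ T a h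
  unique_solution : ∀ a ∈ lamIn '' X, ∀ h₁ h₂, IsIVPSolution f θ T a h₁ →
    IsIVPSolution f θ T a h₂ → Set.EqOn h₁ h₂ (Set.Icc 0 T)

namespace NeuralODE

variable {k nin nhid nout p : ℕ} {X : Set (EuclideanSpace ℝ (Fin nin))}

/-- The solution `h_a` of the initial value problem with `h_a(0) = a`. It is determined on `[0, T]`
for `a ∈ λ(X)`; the values for other `a` are irrelevant. -/
def solution (N : NeuralODE k nin nhid nout p X) (a : EuclideanSpace ℝ (Fin nhid)) :
    ℝ → EuclideanSpace ℝ (Fin nhid) :=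
  Classical.epsilon (IsIVPSolution N.f N.θ N.T a)

/-- The input-output map `x ↦ λ̃(h_{λ(x)}(T))` (meaningful on `X`). -/
def map (N : NeuralODE k nin nhid nout p X) (x : EuclideanSpace ℝ (Fin nin)) :
    EuclideanSpace ℝ (Fin nout) :=
  N.lamOut (N.solution (N.lamIn x) N.T)

/-- The architecture is non-augmented. -/
def NonAugmented (_N : NeuralODE k nin nhid nout p X) : Prop := nhid ≤ nin

end NeuralODE

/-- The Jacobian matrix `(∂ g_i / ∂ x_j)_{i,j}` of `g : ℝ^a → ℝ^b` at `x`. -/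
def jacobianMatrix {a b : ℕ} (g : EuclideanSpace ℝ (Fin a) → EuclideanSpace ℝ (Fin b))
    (x : EuclideanSpace ℝ (Fin a)) : Matrix (Fin b) (Fin a) ℝ :=
  Matrix.of fun i j => fderiv ℝ g x (EuclideanSpace.single j 1) i

/-- Non-singular input and output transformations: both are `C¹` and their Jacobian matrices
have full rank everywhere. -/
def NonSingularTransformations {nin nhid nout : ℕ}
    (lamIn : EuclideanSpace ℝ (Fin nin) → EuclideanSpace ℝ (Fin nhid))
    (lamOut : EuclideanSpace ℝ (Fin nhid) → EuclideanSpace ℝ (Fin nout)) : Prop :=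
  ContDiff ℝ 1 lamIn ∧ ContDiff ℝ 1 lamOut ∧
    (∀ x, (jacobianMatrix lamIn x).rank = nhid) ∧
    (∀ y, (jacobianMatrix lamOut y).rank = min nhid nout)

end

/-! The derivative of the network is a composition of three surjections, hence nonzero. The outer
two are surjective by the rank conditions. For the middle one, the flow map `a ↦ h_a(T)`, solutions
must exist for all initial values near `λ(x)`: a submersion is open, so `λ(X)` is a neighbourhood of
`λ(x)`. The flow map is differentiated without solving the variational equation. Differences to the
reference solution obey an ODE with equilibrium `0` that is nearly linear there, so superpositions
of finitely many of them nearly solve it; Grönwall turns this into approximation by linear maps to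
any accuracy. Backward Grönwall makes the derivative injective, hence surjective in finite
dimension. -/

open Set Filter Topology Metric

/-! ### Derivatives at a point from approximations and expansion bounds -/

/-- A map which near `0` is approximated by linear maps to any relative accuracy is differentiable
at `0`. -/
theorem exists_hasFDerivAt_zero_of_approx {E F : Type*} [NormedAddCommGroup E] [NormedSpace ℝ E]
    [NormedAddCommGroup F] [NormedSpace ℝ F] [CompleteSpace F] {G : E → F} (h0 : G 0 = 0)
    (h : ∀ ε > 0, ∃ L : E →L[ℝ] F, ∀ᶠ v in 𝓝 0, ‖G v - L v‖ ≤ ε * ‖v‖) :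
    ∃ L : E →L[ℝ] F, HasFDerivAt G L 0 := by
  have hpos : ∀ n : ℕ, (0 : ℝ) < 1 / ((n : ℝ) + 1) := fun n => Nat.one_div_pos_of_nat
  choose L hL using fun n : ℕ => h _ (hpos n)
  -- Two approximants are both close to `G` near `0`, and a neighbourhood of `0` controls the
  -- operator norm; so `L` is Cauchy.
  have hdiff : ∀ n m : ℕ, ‖L n - L m‖ ≤ 1 / ((n : ℝ) + 1) + 1 / ((m : ℝ) + 1) := by
    intro n m
    refine ContinuousLinearMap.opNorm_le_of_nhds_zero (by positivity) ?_
    filter_upwards [hL n, hL m] with v hn hm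
    calc ‖(L n - L m) v‖ = ‖(G v - L m v) - (G v - L n v)‖ := by
          congr 1; simp
      _ ≤ ‖G v - L m v‖ + ‖G v - L n v‖ := norm_sub_le _ _
      _ ≤ (1 / ((n : ℝ) + 1) + 1 / ((m : ℝ) + 1)) * ‖v‖ := by linarith
  have hlim : Tendsto (fun n : ℕ => 1 / ((n : ℝ) + 1)) atTop (𝓝 0) :=
    tendsto_one_div_add_atTop_nhds_zero_nat
  have hc : CauchySeq L := by
    refine Metric.cauchySeq_iff'.2 fun ε hε => ?_
    obtain ⟨N, hN⟩ := (hlim.eventually (gt_mem_nhds (half_pos hε))).exists_forall_of_atTop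
    refine ⟨N, fun n hn => ?_⟩
    rw [dist_eq_norm]
    have := hdiff n N
    linarith [hN n hn, hN N le_rfl]
  obtain ⟨L', hL'⟩ := cauchySeq_tendsto_of_complete hc
  refine ⟨L', ?_⟩
  rw [hasFDerivAt_iff_isLittleO_nhds_zero, Asymptotics.isLittleO_iff]
  intro c hc
  obtain ⟨n, hn1, hn2⟩ := ((hlim.eventually (gt_mem_nhds (half_pos hc))).and
    (hL'.eventually (ball_mem_nhds L' (half_pos hc)))).exists
  filter_upwards [hL n] with v hv
  rw [dist_eq_norm] at hn2
  have h2 : ‖(L n - L') v‖ ≤ c / 2 * ‖v‖ := (L n - L').le_of_opNorm_le hn2.le v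
  calc ‖G (0 + v) - G 0 - L' v‖ = ‖(G v - L n v) + (L n - L') v‖ := by
        congr 1; simp [h0]
    _ ≤ ‖G v - L n v‖ + ‖(L n - L') v‖ := norm_add_le _ _
    _ ≤ c / 2 * ‖v‖ + c / 2 * ‖v‖ := by gcongr; exact hv.trans (by gcongr)
    _ = c * ‖v‖ := by ring

/-- A derivative of a map which expands distances to a point is injective. -/
theorem injective_of_hasFDerivAt_of_norm_le {E F : Type*} [NormedAddCommGroup E] [NormedSpace ℝ E]
    [NormedAddCommGroup F] [NormedSpace ℝ F] {G : E → F} {L : E →L[ℝ] F} (h0 : G 0 = 0)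
    (hG : HasFDerivAt G L 0) {C : ℝ} (hC : 0 < C) (h : ∀ᶠ v in 𝓝 0, ‖v‖ ≤ C * ‖G v‖) :
    Function.Injective L := by
  rw [hasFDerivAt_iff_isLittleO_nhds_zero, Asymptotics.isLittleO_iff] at hG
  have hε : 0 < 1 / (2 * C) := by positivity
  obtain ⟨r, hr, hball⟩ := Metric.eventually_nhds_iff.1 (h.and (hG hε))
  refine (injective_iff_map_eq_zero L).2 fun v hv => ?_
  by_contra hne
  have hvpos : 0 < ‖v‖ := norm_pos_iff.2 hne
  -- A kernel vector is rescaled into the ball, where expansion and the `o(‖v‖)` bound give `‖s • v‖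
  -- ≤ ‖s • v‖ / 2`.
  set s : ℝ := r / (2 * ‖v‖)
  have hs : 0 < s := by positivity
  have hsv : ‖s • v‖ = s * ‖v‖ := by rw [norm_smul, Real.norm_of_nonneg hs.le]
  have hsv' : s * ‖v‖ = r / 2 := by simp only [s]; field_simp
  obtain ⟨h1, h2⟩ := hball (y := s • v) (by rw [dist_zero_right, hsv, hsv']; linarith)
  simp only [zero_add, h0, sub_zero, map_smul, hv, smul_zero] at h2
  have : C * ‖G (s • v)‖ ≤ C * (1 / (2 * C) * ‖s • v‖) := by gcongr
  have h3 : C * (1 / (2 * C) * ‖s • v‖) = ‖s • v‖ / 2 := by field_simp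
  rw [hsv, hsv'] at *
  linarith

/-! ### Flows near an equilibrium -/

section NearlyLinear

variable {E : Type*} [NormedAddCommGroup E] [NormedSpace ℝ E]

/-- The time dependent vector field `g` is differentiable at the equilibrium `0` with derivative
`A t`, uniformly for `t ∈ [0, T]`. -/
def IsUniformLinearization (T : ℝ) (g : ℝ → E → E) (A : ℝ → E →L[ℝ] E) : Prop :=
  ∀ ε > 0, ∃ δ > 0, ∀ t ∈ Icc 0 T, ∀ u, ‖u‖ ≤ δ → ‖g t u - A t u‖ ≤ ε * ‖u‖

theorem HasDerivWithinAt.Ici_of_Icc {e : ℝ → E} {e' : E} {a b t : ℝ}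
    (h : HasDerivWithinAt e e' (Icc a b) t) (ht : t ∈ Ico a b) :
    HasDerivWithinAt e e' (Ici t) t :=
  h.mono_of_mem_nhdsWithin (Icc_mem_nhdsGE_of_mem ht)

/-- Forward and backward Grönwall estimates for a curve with `‖e'‖ ≤ M ‖e‖`. -/
theorem norm_le_exp_of_norm_deriv_le {e e' : ℝ → E} {T M : ℝ}
    (he : ∀ t ∈ Icc 0 T, HasDerivWithinAt e (e' t) (Icc 0 T) t)
    (hM : ∀ t ∈ Icc 0 T, ‖e' t‖ ≤ M * ‖e t‖) {t : ℝ} (ht : t ∈ Icc 0 T) :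
    ‖e t‖ ≤ ‖e 0‖ * Real.exp (M * t) := by
  have := norm_le_gronwallBound_of_norm_deriv_right_le (f := e) (f' := e') (δ := ‖e 0‖) (K := M)
    (ε := 0) (fun t ht => (he t ht).continuousWithinAt)
    (fun t ht => (he t (Ico_subset_Icc_self ht)).Ici_of_Icc ht) le_rfl
    (fun t ht => by simpa using hM t (Ico_subset_Icc_self ht)) t ht
  simpa [gronwallBound_ε0] using this

theorem norm_zero_le_exp_of_norm_deriv_le {e e' : ℝ → E} {T M : ℝ} (hT : 0 ≤ T)
    (he : ∀ t ∈ Icc 0 T, HasDerivWithinAt e (e' t) (Icc 0 T) t)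
    (hM : ∀ t ∈ Icc 0 T, ‖e' t‖ ≤ M * ‖e t‖) :
    ‖e 0‖ ≤ ‖e T‖ * Real.exp (M * T) := by
  have hmem : ∀ t ∈ Icc 0 T, T - t ∈ Icc 0 T := fun t ht =>
    ⟨by linarith [ht.2], by linarith [ht.1]⟩
  -- Time reversal `t ↦ T - t` reduces this to the forward estimate.
  have := norm_le_exp_of_norm_deriv_le (e := fun t => e (T - t)) (e' := fun t => -e' (T - t))
    (M := M) (T := T) (fun t ht => ?_) (fun t ht => by simpa using hM _ (hmem t ht))
    (right_mem_Icc.2 hT)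
  · simpa using this
  · have h1 : HasDerivWithinAt (fun t : ℝ => T - t) (-1) (Icc 0 T) t := by
      simpa using (hasDerivWithinAt_id t (Icc 0 T)).const_sub T
    simpa [Function.comp_def] using (he _ (hmem t ht)).scomp t h1 hmem

/-- Solutions starting close to the equilibrium stay close to it and do not approach it faster than
exponentially. -/
theorem IsUniformLinearization.exists_bounds {T : ℝ} (hT : 0 ≤ T) {g : ℝ → E → E}
    {A : ℝ → E →L[ℝ] E} (hg : IsUniformLinearization T g A) {K : ℝ}
    (hK : ∀ t ∈ Icc 0 T, ‖A t‖ ≤ K) :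
    ∃ C > 0, ∃ δ > 0, ∀ e : ℝ → E, ‖e 0‖ ≤ δ →
      (∀ t ∈ Icc 0 T, HasDerivWithinAt e (g t (e t)) (Icc 0 T) t) →
      (∀ t ∈ Icc 0 T, ‖e t‖ ≤ C * ‖e 0‖) ∧ ‖e 0‖ ≤ C * ‖e T‖ := by
  obtain ⟨δ, hδ, hgδ⟩ := hg 1 one_pos
  have hK0 : 0 ≤ K := (norm_nonneg _).trans (hK 0 (left_mem_Icc.2 hT))
  have hgK : ∀ t ∈ Icc 0 T, ∀ u, ‖u‖ ≤ δ → ‖g t u‖ ≤ (K + 1) * ‖u‖ := by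
    intro t ht u hu
    calc ‖g t u‖ = ‖(g t u - A t u) + A t u‖ := by rw [sub_add_cancel]
      _ ≤ ‖g t u - A t u‖ + ‖A t u‖ := norm_add_le _ _
      _ ≤ 1 * ‖u‖ + K * ‖u‖ := add_le_add (hgδ t ht u hu) ((A t).le_of_opNorm_le (hK t ht) u)
      _ = (K + 1) * ‖u‖ := by ring
  -- The barrier `η * exp ((K + 2) * t)` stays below `δ` up to time `T`. Its rate `K + 2` exceeds
  -- the growth rate `K + 1` valid in the `δ`-ball, so a curve starting below cannot cross it.
  set η := δ * Real.exp (-((K + 2) * T)) with hη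
  have hηpos : 0 < η := by positivity
  refine ⟨Real.exp ((K + 1) * T), Real.exp_pos _, η, hηpos, fun e he0 he => ?_⟩
  have hBδ : ∀ t ∈ Icc 0 T, η * Real.exp ((K + 2) * t) ≤ δ := by
    intro t ht
    rw [hη, mul_assoc, ← Real.exp_add]
    refine mul_le_of_le_one_right hδ.le (Real.exp_le_one_iff.2 ?_)
    nlinarith [ht.2]
  have hB : ∀ t, HasDerivAt (fun t => η * Real.exp ((K + 2) * t))
      ((K + 2) * (η * Real.exp ((K + 2) * t))) t := by
    intro t
    have := (((hasDerivAt_id' t).const_mul (K + 2)).exp.const_mul η)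
    exact this.congr_deriv (by ring)
  have hsmall : ∀ t ∈ Icc 0 T, ‖e t‖ ≤ δ := by
    intro t ht
    refine le_trans (image_norm_le_of_norm_deriv_right_lt_deriv_boundary
      (fun t ht => (he t ht).continuousWithinAt)
      (fun t ht => (he t (Ico_subset_Icc_self ht)).Ici_of_Icc ht) (by simpa using he0) hB
      (fun t ht hEq => ?_) ht) (hBδ t ht)
    have ht' := Ico_subset_Icc_self ht
    have hpos : 0 < η * Real.exp ((K + 2) * t) := by positivity
    have := hgK t ht' (e t) (hEq.le.trans (hBδ t ht'))
    rw [hEq] at this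
    linarith
  have hM : ∀ t ∈ Icc 0 T, ‖g t (e t)‖ ≤ (K + 1) * ‖e t‖ := fun t ht =>
    hgK t ht _ (hsmall t ht)
  refine ⟨fun t ht => (norm_le_exp_of_norm_deriv_le he hM ht).trans ?_, ?_⟩
  · rw [mul_comm]
    gcongr
    exact ht.2
  · rw [mul_comm]
    exact norm_zero_le_exp_of_norm_deriv_le hT he hM

/-- The end-time map of a flow near an equilibrium is differentiable there, with injective
derivative. -/
theorem IsUniformLinearization.exists_hasFDerivAt [FiniteDimensional ℝ E] {T : ℝ} (hT : 0 ≤ T)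
    {g : ℝ → E → E} {A : ℝ → E →L[ℝ] E} (hg : IsUniformLinearization T g A) {K : ℝ}
    (hK : ∀ t ∈ Icc 0 T, ‖A t‖ ≤ K) {e : E → ℝ → E} (he : ∀ᶠ v in 𝓝 0, e v 0 = v ∧
      ∀ t ∈ Icc 0 T, HasDerivWithinAt (e v) (g t (e v t)) (Icc 0 T) t) :
    ∃ L : E →L[ℝ] E, HasFDerivAt (fun v => e v T) L 0 ∧ Function.Injective L := by
  have hTmem : T ∈ Icc 0 T := right_mem_Icc.2 hT
  have hK0 : 0 ≤ K := (norm_nonneg _).trans (hK 0 (left_mem_Icc.2 hT))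
  obtain ⟨C, hC, δ₀, hδ₀, hbd⟩ := hg.exists_bounds hT hK
  have hsmall : ∀ᶠ v : E in 𝓝 0, ‖v‖ ≤ δ₀ ∧ e v 0 = v ∧
      (∀ t ∈ Icc 0 T, HasDerivWithinAt (e v) (g t (e v t)) (Icc 0 T) t) := by
    filter_upwards [he, closedBall_mem_nhds (0 : E) hδ₀] with v hv hv'
    exact ⟨by simpa using hv', hv⟩
  have hest : ∀ᶠ v : E in 𝓝 0, e v 0 = v ∧
      (∀ t ∈ Icc 0 T, HasDerivWithinAt (e v) (g t (e v t)) (Icc 0 T) t) ∧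
      (∀ t ∈ Icc 0 T, ‖e v t‖ ≤ C * ‖v‖) ∧ ‖v‖ ≤ C * ‖e v T‖ := by
    filter_upwards [hsmall] with v hv
    have := hbd (e v) (by rw [hv.2.1]; exact hv.1) hv.2.2
    rw [hv.2.1] at this
    exact ⟨hv.2.1, hv.2.2, this⟩
  have hzero : e 0 T = 0 := by
    have := hest.self_of_nhds.2.2.1 T hTmem
    simpa using this
  suffices h : ∃ L : E →L[ℝ] E, HasFDerivAt (fun v => e v T) L 0 by
    obtain ⟨L, hL⟩ := h
    exact ⟨L, hL, injective_of_hasFDerivAt_of_norm_le hzero hL hC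
      (hest.mono fun v hv => hv.2.2.2)⟩
  refine exists_hasFDerivAt_zero_of_approx hzero fun ε hε => ?_
  let b := Module.finBasis ℝ E
  let φ := fun i => (b.coord i).toContinuousLinearMap
  have hsum : ∀ v, ∑ i, φ i v • b i = v := fun v => b.sum_repr v
  set S : ℝ := ∑ i, ‖φ i‖ * ‖b i‖
  have hS0 : 0 ≤ S := Finset.sum_nonneg fun i _ => by positivity
  set B : ℝ := gronwallBound 0 K 1 T with hB
  have hB0 : 0 ≤ B := by
    simpa [gronwallBound_x0] using
      gronwallBound_mono (δ := 0) (ε := 1) le_rfl zero_le_one hK0 hT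
  have hBρ : ∀ ρ, gronwallBound 0 K ρ T = ρ * B := by
    intro ρ
    simp only [hB, gronwallBound]
    split_ifs <;> ring
  -- Chosen so that the final error `ρ * C * (1 + S) * B * ‖v‖` is at most `ε * ‖v‖`; `B + 1`
  -- replaces `B`, which vanishes for `T = 0`.
  set ρ : ℝ := ε / ((B + 1) * (C * (1 + S))) with hρ
  have hρpos : 0 < ρ := by positivity
  obtain ⟨δ, hδ, hgδ⟩ := hg ρ hρpos
  have happ : ∀ᶠ v : E in 𝓝 0, e v 0 = v ∧
      (∀ t ∈ Icc 0 T, HasDerivWithinAt (e v) (g t (e v t)) (Icc 0 T) t) ∧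
      ∀ t ∈ Icc 0 T, ‖g t (e v t) - A t (e v t)‖ ≤ ρ * C * ‖v‖ := by
    filter_upwards [hest, closedBall_mem_nhds (0 : E) (div_pos hδ hC)] with v hv hv'
    rw [mem_closedBall_zero_iff, le_div_iff₀ hC, mul_comm] at hv'
    refine ⟨hv.1, hv.2.1, fun t ht => ?_⟩
    have hle := hv.2.2.1 t ht
    refine (hgδ t ht _ (hle.trans hv')).trans ?_
    rw [mul_assoc]
    gcongr
  obtain ⟨s, hs, hs0⟩ : ∃ s : ℝ, (∀ i, e (s • b i) 0 = s • b i ∧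
      (∀ t ∈ Icc 0 T, HasDerivWithinAt (e (s • b i)) (g t (e (s • b i) t)) (Icc 0 T) t) ∧
      ∀ t ∈ Icc 0 T, ‖g t (e (s • b i) t) - A t (e (s • b i) t)‖ ≤ ρ * C * ‖s • b i‖) ∧ 0 < s := by
    have : ∀ᶠ s : ℝ in 𝓝[>] 0, ∀ i, e (s • b i) 0 = s • b i ∧
        (∀ t ∈ Icc 0 T, HasDerivWithinAt (e (s • b i)) (g t (e (s • b i) t)) (Icc 0 T) t) ∧
        ∀ t ∈ Icc 0 T,
          ‖g t (e (s • b i) t) - A t (e (s • b i) t)‖ ≤ ρ * C * ‖s • b i‖ := by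
      refine eventually_all.2 fun i => ?_
      have ht : Tendsto (fun s : ℝ => s • b i) (𝓝[>] 0) (𝓝 0) := by
        have : Continuous fun s : ℝ => s • b i := by fun_prop
        simpa using (this.tendsto 0).mono_left nhdsWithin_le_nhds
      exact ht.eventually happ
    obtain ⟨s, hs⟩ := (this.and self_mem_nhdsWithin).exists
    exact ⟨s, hs⟩
  -- The approximant extends linearly the end points of the solutions starting at the small
  -- multiples `s • b i`, rescaled by `s⁻¹`.
  refine ⟨∑ i, (φ i).smulRight (s⁻¹ • e (s • b i) T), ?_⟩
  filter_upwards [happ] with v hv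
  -- The superposition error `w` starts at `0` and satisfies the linearized equation up to a
  -- multiple of `ρ * ‖v‖`.
  set w : ℝ → E := fun t => e v t - ∑ i, (φ i v * s⁻¹) • e (s • b i) t with hw
  set w' : ℝ → E := fun t => g t (e v t) - ∑ i, (φ i v * s⁻¹) • g t (e (s • b i) t) with hw'
  have hderiv : ∀ t ∈ Icc 0 T, HasDerivWithinAt w (w' t) (Icc 0 T) t := fun t ht =>
    (hv.2.1 t ht).sub (HasDerivWithinAt.fun_sum fun i _ => ((hs i).2.1 t ht).const_smul _)
  have hw0 : w 0 = 0 := by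
    simp only [hw, hv.1, (hs _).1, smul_smul, mul_assoc, inv_mul_cancel₀ hs0.ne', mul_one, hsum,
      sub_self]
  have hbound : ∀ t ∈ Icc 0 T, ‖w' t‖ ≤ K * ‖w t‖ + ρ * C * (1 + S) * ‖v‖ := by
    intro t ht
    have hsplit : w' t = A t (w t) + ((g t (e v t) - A t (e v t)) -
        ∑ i, (φ i v * s⁻¹) • (g t (e (s • b i) t) - A t (e (s • b i) t))) := by
      simp only [hw, hw', map_sub, map_sum, map_smul, smul_sub, Finset.sum_sub_distrib]
      abel
    have hterm : ∀ i, ‖(φ i v * s⁻¹) • (g t (e (s • b i) t) - A t (e (s • b i) t))‖ ≤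
        ρ * C * ‖v‖ * (‖φ i‖ * ‖b i‖) := by
      intro i
      rw [norm_smul, norm_mul, norm_inv, Real.norm_of_nonneg hs0.le]
      calc ‖φ i v‖ * s⁻¹ * ‖g t (e (s • b i) t) - A t (e (s • b i) t)‖
          ≤ (‖φ i‖ * ‖v‖) * s⁻¹ * (ρ * C * ‖s • b i‖) := by
            gcongr
            · exact (φ i).le_opNorm v
            · exact (hs i).2.2 t ht
        _ = ρ * C * ‖v‖ * (‖φ i‖ * ‖b i‖) := by
            rw [norm_smul, Real.norm_of_nonneg hs0.le]
            field_simp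
    calc ‖w' t‖ ≤ ‖A t (w t)‖ + (‖g t (e v t) - A t (e v t)‖ +
          ∑ i, ‖(φ i v * s⁻¹) • (g t (e (s • b i) t) - A t (e (s • b i) t))‖) := by
          rw [hsplit]
          refine (norm_add_le _ _).trans (add_le_add_right ((norm_sub_le _ _).trans ?_) _)
          exact add_le_add_right (norm_sum_le _ _) _
      _ ≤ K * ‖w t‖ + (ρ * C * ‖v‖ + ∑ i, ρ * C * ‖v‖ * (‖φ i‖ * ‖b i‖)) :=
          add_le_add ((A t).le_of_opNorm_le (hK t ht) _)
            (add_le_add (hv.2.2 t ht) (Finset.sum_le_sum fun i _ => hterm i))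
      _ = K * ‖w t‖ + ρ * C * (1 + S) * ‖v‖ := by
          rw [← Finset.mul_sum]; ring
  have hfin := norm_le_gronwallBound_of_norm_deriv_right_le (δ := 0)
    (fun t ht => (hderiv t ht).continuousWithinAt)
    (fun t ht => (hderiv t (Ico_subset_Icc_self ht)).Ici_of_Icc ht) (by simp [hw0])
    (fun t ht => hbound t (Ico_subset_Icc_self ht)) T hTmem
  rw [sub_zero, hBρ] at hfin
  have hwT : e v T - (∑ i, (φ i).smulRight (s⁻¹ • e (s • b i) T)) v = w T := by
    simp [hw, smul_smul]
  calc ‖e v T - (∑ i, (φ i).smulRight (s⁻¹ • e (s • b i) T)) v‖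
      ≤ ρ * C * (1 + S) * ‖v‖ * B := by rw [hwT]; exact hfin
    _ ≤ ρ * C * (1 + S) * ‖v‖ * (B + 1) := by gcongr; linarith
    _ = ε * ‖v‖ := by rw [hρ]; field_simp

end NearlyLinear

/-! ### Linearization along a solution and the flow map -/

/-- A vector field of class `C^{1,0}` is differentiable along a curve, uniformly on compact time
intervals. -/
theorem IsCk0.isUniformLinearization {E P : Type*} [NormedAddCommGroup E] [NormedSpace ℝ E]
    [PseudoMetricSpace P] {f : E → P → E} (hf : IsCk0 1 f) {θ : ℝ → P} {T : ℝ}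
    (hθ : ContinuousOn θ (Icc 0 T)) {h : ℝ → E} (hh : ContinuousOn h (Icc 0 T)) :
    IsUniformLinearization T (fun t u => f (h t + u) (θ t) - f (h t) (θ t))
        (fun t => fderiv ℝ (fun x => f x (θ t)) (h t)) ∧
      ∃ K, ∀ t ∈ Icc 0 T, ‖fderiv ℝ (fun x => f x (θ t)) (h t)‖ ≤ K := by
  have hD : Continuous fun q : E × P => fderiv ℝ (fun x => f x q.2) q.1 := by
    have h1 := (continuousMultilinearCurryFin1 ℝ E E).continuous.comp (hf.2 1 le_rfl)
    refine h1.congr fun q => ?_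
    ext v
    simp [continuousMultilinearCurryFin1_apply, iteratedFDeriv_one_apply]
  have hcurve : ContinuousOn (fun t => (h t, θ t)) (Icc 0 T) := hh.prodMk hθ
  have hcomp : IsCompact ((fun t => (h t, θ t)) '' Icc 0 T) :=
    isCompact_Icc.image_of_continuousOn hcurve
  refine ⟨fun ε hε => ?_, isCompact_Icc.exists_bound_of_continuousOn (hD.comp_continuousOn hcurve)⟩
  -- Uniformity needs only one of the two points to lie on the compact curve.
  have hU := hcomp.uniformContinuousAt_of_continuousAt _ (fun q _ => hD.continuousAt)
    (Metric.dist_mem_uniformity hε)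
  obtain ⟨δ, hδ, hδU⟩ := Metric.mem_uniformity_dist.1 hU
  refine ⟨δ / 2, half_pos hδ, fun t ht u hu => ?_⟩
  have hdiff : ∀ y, Differentiable ℝ fun x => f x y := fun y =>
    (hf.1 y).differentiable (by simp)
  have := (convex_closedBall (h t) (δ / 2)).norm_image_sub_le_of_norm_fderiv_le' (𝕜 := ℝ)
    (f := fun x => f x (θ t)) (φ := fderiv ℝ (fun x => f x (θ t)) (h t)) (C := ε)
    (fun x _ => hdiff _ x) (fun x hx => ?_) (x := h t) (y := h t + u)
    (mem_closedBall_self (half_pos hδ).le) (by simpa using hu)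
  · simpa using this
  · have hd : dist (h t, θ t) (x, θ t) < δ := by
      rw [mem_closedBall, dist_comm] at hx
      rw [Prod.dist_eq, dist_self]
      exact max_lt (by linarith) hδ
    have := hδU hd ⟨t, ht, rfl⟩
    rw [mem_ofPred_eq, dist_comm, dist_eq_norm] at this
    exact this.le

/-- The time `T` map of an initial value problem which is solvable for all initial values near `a`
is differentiable at `a`, with bijective derivative. -/
theorem exists_hasFDerivAt_of_isIVPSolution {E P : Type*} [NormedAddCommGroup E] [NormedSpace ℝ E]
    [FiniteDimensional ℝ E] [PseudoMetricSpace P] {f : E → P → E} (hf : IsCk0 1 f) {θ : ℝ → P}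
    {T : ℝ} (hT : 0 ≤ T) (hθ : ContinuousOn θ (Icc 0 T)) {h : E → ℝ → E} {a : E}
    (hh : ∀ᶠ c in 𝓝 a, IsIVPSolution f θ T c (h c)) :
    ∃ L : E →L[ℝ] E, HasFDerivAt (fun c => h c T) L a ∧ Function.Surjective L := by
  have ha := hh.self_of_nhds
  obtain ⟨hlin, K, hK⟩ := hf.isUniformLinearization hθ
    (fun t ht => (ha.2 t ht).continuousWithinAt)
  have hadd : Tendsto (fun v => a + v) (𝓝 0) (𝓝 a) := by
    simpa using (continuous_const_add a).tendsto 0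
  obtain ⟨L, hL, hinj⟩ := hlin.exists_hasFDerivAt hT hK (e := fun v t => h (a + v) t - h a t) <| by
    filter_upwards [hadd.eventually hh] with v hv
    refine ⟨by rw [hv.1, ha.1, add_sub_cancel_left], fun t ht => ?_⟩
    simpa using (hv.2 t ht).fun_sub (ha.2 t ht)
  refine ⟨L, ?_, LinearMap.surjective_of_injective (f := (L : E →ₗ[ℝ] E)) hinj⟩
  rw [hasFDerivAt_iff_isLittleO_nhds_zero] at hL ⊢
  refine hL.congr_left fun v => ?_
  simp

/-! ### Rank conditions and the main theorem -/

theorem jacobianMatrix_mulVec {a b : ℕ} (g : EuclideanSpace ℝ (Fin a) → EuclideanSpace ℝ (Fin b))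
    (x : EuclideanSpace ℝ (Fin a)) (v : Fin a → ℝ) :
    (jacobianMatrix g x).mulVec v = WithLp.ofLp (fderiv ℝ g x (WithLp.toLp 2 v)) := by
  have hv : WithLp.toLp 2 v = ∑ j, v j • EuclideanSpace.single j (1 : ℝ) := by
    ext i
    simp [Finset.sum_apply, Pi.single_apply]
  ext i
  rw [hv]
  simp [jacobianMatrix, Matrix.mulVec, dotProduct, mul_comm]

theorem fderiv_surjective_of_rank_jacobianMatrix {a b : ℕ}
    {g : EuclideanSpace ℝ (Fin a) → EuclideanSpace ℝ (Fin b)} {x : EuclideanSpace ℝ (Fin a)}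
    (h : (jacobianMatrix g x).rank = b) : Function.Surjective (fderiv ℝ g x) := by
  have htop : LinearMap.range (jacobianMatrix g x).mulVecLin = ⊤ :=
    Submodule.eq_top_of_finrank_eq (by simpa [Matrix.rank] using h)
  intro y
  obtain ⟨v, hv⟩ := LinearMap.range_eq_top.1 htop (WithLp.ofLp y)
  refine ⟨WithLp.toLp 2 v, WithLp.ofLp_injective 2 ?_⟩
  rw [← jacobianMatrix_mulVec]
  exact hv

theorem theorem3p6 {nin nhid p : ℕ} (hhid : 1 ≤ nhid)
    (X : Set (EuclideanSpace ℝ (Fin nin)))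
    (N : NeuralODE 1 nin nhid 1 p X) (hN : N.NonAugmented)
    (hC : NonSingularTransformations N.lamIn N.lamOut) :
    ∀ x ∈ X, DifferentiableAt ℝ (fun z => N.map z 0) x ∧
      gradient (fun z => N.map z 0) x ≠ 0 := by
  intro x hx
  obtain ⟨hIn, hOut, hInRank, hOutRank⟩ := hC
  have hInSurj := fderiv_surjective_of_rank_jacobianMatrix (hInRank x)
  have hInStrict : HasStrictFDerivAt N.lamIn (fderiv ℝ N.lamIn x) x :=
    hIn.contDiffAt.hasStrictFDerivAt (by simp)
  have himage : N.lamIn '' X ∈ 𝓝 (N.lamIn x) := by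
    rw [← hInStrict.map_nhds_eq_of_surj (LinearMap.range_eq_top.2 hInSurj)]
    exact image_mem_map (N.isOpen_X.mem_nhds hx)
  have hsol : ∀ᶠ c in 𝓝 (N.lamIn x), IsIVPSolution N.f N.θ N.T c (N.solution c) := by
    filter_upwards [himage] with c hc
    exact Classical.epsilon_spec (N.exists_solution c hc)
  obtain ⟨L, hL, hLSurj⟩ :=
    exists_hasFDerivAt_of_isIVPSolution N.f_regular N.T_nonneg N.θ_continuousOn hsol
  set y := N.solution (N.lamIn x) N.T
  have hOutSurj := fderiv_surjective_of_rank_jacobianMatrix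
    ((hOutRank y).trans (min_eq_right hhid))
  have hOutDeriv : HasFDerivAt N.lamOut (fderiv ℝ N.lamOut y) y :=
    (hOut.differentiable (by simp) y).hasFDerivAt
  have hmap : HasFDerivAt N.map ((fderiv ℝ N.lamOut y).comp (L.comp (fderiv ℝ N.lamIn x))) x :=
    hOutDeriv.comp x (hL.comp x hInStrict.hasFDerivAt)
  have hcoord :=
    (EuclideanSpace.proj (0 : Fin 1) : EuclideanSpace ℝ (Fin 1) →L[ℝ] ℝ).hasFDerivAt.comp x hmap
  refine ⟨hcoord.differentiableAt, fun hgrad => ?_⟩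
  have hzero : fderiv ℝ (fun z => N.map z 0) x = 0 := by
    simpa [gradient] using hgrad
  -- A direction along which the output has derivative `1` contradicts a vanishing gradient.
  obtain ⟨v, hv⟩ := (hOutSurj.comp (hLSurj.comp hInSurj)) (EuclideanSpace.single 0 1)
  have hval := congrArg (fun l => l v) (hcoord.fderiv.symm.trans hzero)
  have hone : fderiv ℝ N.lamOut y (L (fderiv ℝ N.lamIn x v)) 0 = 1 := by
    simpa using congrArg (fun z : EuclideanSpace ℝ (Fin 1) => z 0) hv
  exact one_ne_zero (hone.symm.trans hval)
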